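/- Theorem 3.1. A measure network is a triple $\mathcal X=(X,\omega_X,\mu_X)$ where $X$ is a Polish space, $\mu_X$ is a Borel probability measure on $X$ with full support, and $\omega_X:X\times X\to\mathbb R$ is a Borel measurable function (no continuity, boundedness or symmetry is assumed). For $p\in[1,\infty)$ its $p$-size is $$\mathrm{size}_p(\mathcal X)=\Big(\iint_{X\times X}|\omega_X(x,x')|^p\,\mu_X(dx)\,\mu_X(dx')\Big)^{1/p}\in[0,\infty].$$ For measure networks $\mathcal X,\mathcal Y$, let $\mathcal C(\mu_X,\mu_Y)$ be the set of probability measures on $X\times Y$ with marginals $\mu_X$ and $\mu_Y$, and let $\mathcal T(\mu_X,\mu_Y)$ be the set of measurable maps $\phi:X\to Y$ with $\phi_\#\mu_X=\mu_Y$. For $\pi\in\mathcal C(\mu_X,\mu_Y)$ put $$\mathrm{dis}_p(\pi)=\Big(\iint_{(X\times Y)^2}|\omega_X(x,x')-\omega_Y(y,y')|^p\,\pi(dx\times dy)\,\pi(dx'\times dy')\Big)^{1/p}\in[0,\infty],$$ and for $\phi\in\mathcal T(\mu_X,\mu_Y)$ let $\pi_\phi\in\mathcal C(\mu_X,\mu_Y)$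 be the push-forward of $\mu_X$ under $x\mapsto(x,\phi(x))$. Define $$\mathrm{GW}_p(\mathcal X,\mathcal Y)=\inf_{\pi\in\mathcal C(\mu_X,\mu_Y)}\mathrm{dis}_p(\pi),\qquad \mathrm{GM}_p(\mathcal X,\mathcal Y)=\inf_{\phi\in\mathcal T(\mu_X,\mu_Y)}\mathrm{dis}_p(\pi_\phi),$$ where the infimum over the empty set is $\infty$. Let $p\in[1,\infty)$ and let $\mathcal X$ and $\mathcal Y$ be measure networks with $\mathrm{size}_p(\mathcal X)<\infty$ and $\mathrm{size}_p(\mathcal Y)<\infty$ such that $\mu_X$ and $\mu_Y$ are non-atomic, i.e. assign mass zero to every singleton. Then $$\mathrm{GM}_p(\mathcal X,\mathcal Y)=\mathrm{GW}_p(\mathcal X,\mathcal Y).$$ -/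

import Mathlib

open MeasureTheory
open scoped ENNReal

universe u v

/-- A measure network: a Polish space with its Borel σ-algebra, a fully supported Borel
probability measure `μ`, and an arbitrary (Borel) measurable real function `ω` on the square. -/
structure MeasureNetwork where
  carrier : Type u
  [topologicalSpace : TopologicalSpace carrier]
  [polishSpace : PolishSpace carrier]
  [measurableSpace : MeasurableSpace carrier]
  [borelSpace : BorelSpace carrier]
  μ : Measure carrier
  [isProbabilityMeasure : IsProbabilityMeasure μ]
  [isOpenPosMeasure : μ.IsOpenPosMeasure]
  ω : carrier × carrier → ℝ
  measurable_ω : Measurable ω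

namespace MeasureNetwork

attribute [instance] topologicalSpace polishSpace measurableSpace borelSpace
  isProbabilityMeasure isOpenPosMeasure

noncomputable section

/-- The `p`-size `(∬ |ω(x, x')|^p μ(dx) μ(dx'))^(1/p)`, with values in `[0, ∞]`. -/
def size (p : ℝ) (X : MeasureNetwork.{u}) : ℝ≥0∞ :=
  (∫⁻ z : X.carrier × X.carrier, ENNReal.ofReal (|X.ω z| ^ p) ∂(X.μ.prod X.μ)) ^ (1 / p)

/-- The couplings of `μ_X` and `μ_Y`: probability measures on the product with these marginals. -/
def couplings (X : MeasureNetwork.{u}) (Y : MeasureNetwork.{v}) :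
    Set (Measure (X.carrier × Y.carrier)) :=
  {π | IsProbabilityMeasure π ∧ π.map Prod.fst = X.μ ∧ π.map Prod.snd = Y.μ}

/-- The `p`-distortion of a measure `π` on the product (used for couplings `π`), with values in
`[0, ∞]`: the `p`-th root of the integral of `|ω_X(x, x') - ω_Y(y, y')|^p`
over `((x, y), (x', y'))` with respect to `π ⊗ π`. -/
def distortion (p : ℝ) (X : MeasureNetwork.{u}) (Y : MeasureNetwork.{v})
    (π : Measure (X.carrier × Y.carrier)) : ℝ≥0∞ :=
  (∫⁻ w : (X.carrier × Y.carrier) × (X.carrier × Y.carrier),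
    ENNReal.ofReal (|X.ω (w.1.1, w.2.1) - Y.ω (w.1.2, w.2.2)| ^ p) ∂(π.prod π)) ^ (1 / p)

/-- The coupling induced by a map `φ : X → Y`: the push-forward of `μ_X` by `x ↦ (x, φ x)`. -/
def inducedCoupling (X : MeasureNetwork.{u}) (Y : MeasureNetwork.{v})
    (φ : X.carrier → Y.carrier) : Measure (X.carrier × Y.carrier) :=
  X.μ.map (fun x => (x, φ x))

/-- The Gromov–Wasserstein `p`-distance: the infimum of the distortion over all couplings. -/
def GW (p : ℝ) (X : MeasureNetwork.{u}) (Y : MeasureNetwork.{v}) : ℝ≥0∞ :=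
  ⨅ π ∈ couplings X Y, distortion p X Y π

/-- The Gromov–Monge `p`-distance: the infimum of the distortion over the couplings induced by
measure-preserving maps (it is `∞` if there is no such map). -/
def GM (p : ℝ) (X : MeasureNetwork.{u}) (Y : MeasureNetwork.{v}) : ℝ≥0∞ :=
  ⨅ φ ∈ {φ : X.carrier → Y.carrier | MeasurePreserving φ X.μ Y.μ},
    distortion p X Y (inducedCoupling X Y φ)

end

end MeasureNetwork

open ProbabilityTheory Filter Topology unitInterval

/-! ### Transport maps out of non-atomic measures. -/

namespace MeasureTheory

/-! `GW ≤ GM` because maps induce couplings. Conversely, given a coupling `π`, approximate `ω_X` in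
`L^p` by `g (s x, s x')` with `s` simple. By Minkowski this moves the distortion of every coupling
by at most the `L^p` error (`distortionWith_le_add`), and the new distortion depends only on the law
of `(s x, y)`. On each cell of `s`, non-atomicity provides a map sending the conditioned `μ_X` to
the second marginal of the conditioned `π`. The glued map `φ` satisfies `(s x, φ x) ∼ (s x, y)`
(`exists_measurable_map_prodMk_eq`), so it preserves measure and has the same approximate distortion
as `π`. -/

theorem continuous_cdf_of_nullSingletonClass (μ : Measure ℝ) [IsProbabilityMeasure μ] [NullSingletonClass μ] :
    Continuous (cdf μ) := by
  refine continuous_iff_continuousAt.2 fun x => ?_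
  rw [(monotone_cdf μ).continuousAt_iff_leftLim_eq_rightLim, StieltjesFunction.rightLim_eq]
  have h := (cdf μ).measure_singleton x
  rw [measure_cdf, measure_singleton, eq_comm, ENNReal.ofReal_eq_zero, sub_nonpos] at h
  exact le_antisymm ((monotone_cdf μ).leftLim_le le_rfl) h

/-- The probability integral transform. -/
theorem measure_setOf_cdf_le (μ : Measure ℝ) [IsProbabilityMeasure μ] [NullSingletonClass μ] {t : ℝ}
    (h0 : 0 ≤ t) (h1 : t ≤ 1) : μ {x | cdf μ x ≤ t} = ENNReal.ofReal t := by
  have hsurj : ∀ u : ℝ, 0 < u → u < 1 → ∃ x, cdf μ x = u := fun u hu0 hu1 =>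
    mem_range_of_exists_le_of_exists_ge (continuous_cdf_of_nullSingletonClass μ)
      (((tendsto_cdf_atBot μ).eventually (ge_mem_nhds hu0)).exists)
      (((tendsto_cdf_atTop μ).eventually (le_mem_nhds hu1)).exists)
  apply le_antisymm
  -- The main argument needs an attained level `u` with `t < u < 1`, so `t = 1` is separate.
  · rcases h1.eq_or_lt with rfl | h1
    · simpa using prob_le_one
    · refine ENNReal.le_of_forall_pos_le_add fun ε hε _ => ?_
      obtain ⟨u, hu, hu'⟩ := exists_between (lt_min h1 (lt_add_of_pos_right t hε))
      obtain ⟨x, hx⟩ := hsurj u (h0.trans_lt hu) (hu'.trans_le (min_le_left _ _))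
      calc μ {y | cdf μ y ≤ t} ≤ μ (Set.Iic x) := measure_mono fun y hy => by
            by_contra hxy
            have := monotone_cdf μ (not_le.1 hxy).le
            have hy : cdf μ y ≤ t := hy
            linarith
        _ = ENNReal.ofReal u := by rw [← ofReal_cdf, hx]
        _ ≤ ENNReal.ofReal (t + ε) := ENNReal.ofReal_le_ofReal (hu'.le.trans (min_le_right _ _))
        _ ≤ ENNReal.ofReal t + ε := by
            simpa using ENNReal.ofReal_add_le (p := t) (q := (ε : ℝ))
  · refine ENNReal.ofReal_le_of_le_toReal ?_
    refine le_of_forall_lt_imp_le_of_dense fun u hu => ?_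
    rcases le_or_gt u 0 with hu0 | hu0
    · exact hu0.trans ENNReal.toReal_nonneg
    obtain ⟨x, hx⟩ := hsurj u hu0 (hu.trans_le h1)
    rw [← hx, ProbabilityTheory.cdf_eq_real]
    refine measureReal_mono fun y hy => ?_
    exact (monotone_cdf μ hy).trans (hx.le.trans hu.le)

/-- Embed `α` measurably in `ℝ`; the image measure is still non-atomic, and its own cdf makes it
uniform. -/
theorem exists_measurable_map_eq_unitInterval_volume {α : Type*} [MeasurableSpace α]
    [StandardBorelSpace α] (μ : Measure α) [IsProbabilityMeasure μ] [NullSingletonClass μ] :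
    ∃ f : α → I, Measurable f ∧ μ.map f = volume := by
  have he := measurableEmbedding_embeddingReal α
  have : IsProbabilityMeasure (μ.map (embeddingReal α)) :=
    Measure.isProbabilityMeasure_map he.measurable.aemeasurable
  have : NullSingletonClass (μ.map (embeddingReal α)) := ⟨fun x => by
    rw [he.map_apply]
    exact (Set.subsingleton_singleton.preimage he.injective).measure_zero μ⟩
  set ν := μ.map (embeddingReal α) with hν
  let f : ℝ → I := fun x => ⟨cdf ν x, cdf_nonneg ν x, cdf_le_one ν x⟩
  have hf : Measurable f := (monotone_cdf ν).measurable.subtype_mk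
  refine ⟨f ∘ embeddingReal α, hf.comp he.measurable, ?_⟩
  rw [← Measure.map_map hf he.measurable, ← hν]
  have : IsProbabilityMeasure (ν.map f) := Measure.isProbabilityMeasure_map hf.aemeasurable
  refine Measure.ext_of_Iic _ _ fun t => ?_
  rw [Measure.map_apply hf measurableSet_Iic, unitInterval.volume_Iic,
    ← measure_setOf_cdf_le ν t.2.1 t.2.2]
  rfl

theorem exists_measurable_map_eq_of_nullSingletonClass {α β : Type*} [MeasurableSpace α]
    [StandardBorelSpace α] [MeasurableSpace β] [StandardBorelSpace β]
    (μ : Measure α) [IsProbabilityMeasure μ] [NullSingletonClass μ]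
    (ν : Measure β) [IsProbabilityMeasure ν] : ∃ f : α → β, Measurable f ∧ μ.map f = ν := by
  have := nonempty_of_isProbabilityMeasure ν
  obtain ⟨f, hf, hμ⟩ := exists_measurable_map_eq_unitInterval_volume μ
  obtain ⟨g, hg, hν⟩ := ν.exists_measurable_map_eq
  exact ⟨g ∘ f, hg.comp hf, by rw [← Measure.map_map hg hf, hμ, hν]⟩

/-- A coupling of a non-atomic measure can be realised by a map, up to discretising the first
coordinate. -/
theorem exists_measurable_map_prodMk_eq {α β ι : Type*} [MeasurableSpace α]
    [StandardBorelSpace α] [MeasurableSpace β] [StandardBorelSpace β] [MeasurableSpace ι]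
    (μ : Measure α) [IsProbabilityMeasure μ] [NullSingletonClass μ]
    (π : Measure (α × β)) [IsProbabilityMeasure π] (hπ : π.map Prod.fst = μ)
    (s : SimpleFunc α ι) :
    ∃ φ : α → β, Measurable φ ∧
      μ.map (fun x => (s x, φ x)) = π.map (fun z => (s z.1, z.2)) := by
  have hπs : ∀ A, MeasurableSet A → π (Prod.fst ⁻¹' A) = μ A := fun A hA => by
    rw [← hπ, Measure.map_apply measurable_fst hA]
  have : Nonempty β := (nonempty_of_isProbabilityMeasure π).map Prod.snd
  have key : ∀ i : ι, ∃ f : α → β, Measurable f ∧ ∀ B, MeasurableSet B →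
      μ (s ⁻¹' {i} ∩ f ⁻¹' B) = π (Prod.fst ⁻¹' (s ⁻¹' {i}) ∩ Prod.snd ⁻¹' B) := fun i => by
    have hi := s.measurableSet_fiber i
    have hi' : MeasurableSet (Prod.fst ⁻¹' (s ⁻¹' {i}) : Set (α × β)) := measurable_fst hi
    -- Conditioning on a null cell is meaningless, but there both sides vanish and any map will do.
    rcases eq_or_ne (μ (s ⁻¹' {i})) 0 with h0 | h0
    · refine ⟨fun _ => Classical.arbitrary β, measurable_const, fun B _ => ?_⟩
      rw [measure_inter_null_of_null_left _ h0,
        measure_inter_null_of_null_left _ ((hπs _ hi).trans h0)]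
    · have := cond_isProbabilityMeasure h0
      have := cond_isProbabilityMeasure ((hπs _ hi).trans_ne h0)
      have : NullSingletonClass μ[|s ⁻¹' {i}] := ⟨fun x =>
        cond_absolutelyContinuous (measure_singleton x)⟩
      have : IsProbabilityMeasure (π[|Prod.fst ⁻¹' (s ⁻¹' {i})].map Prod.snd) :=
        Measure.isProbabilityMeasure_map measurable_snd.aemeasurable
      obtain ⟨f, hf, hfm⟩ := exists_measurable_map_eq_of_nullSingletonClass μ[|s ⁻¹' {i}]
        (π[|Prod.fst ⁻¹' (s ⁻¹' {i})].map Prod.snd)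
      refine ⟨f, hf, fun B hB => ?_⟩
      rw [← cond_mul_eq_inter hi, ← cond_mul_eq_inter hi', hπs _ hi,
        ← Measure.map_apply hf hB, hfm, Measure.map_apply measurable_snd hB]
  choose f hf hfm using key
  have hφ : Measurable fun x => f (s x) x := s.measurable_bind (fun i x => f i x) hf
  refine ⟨fun x => f (s x) x, hφ, ?_⟩
  have hs₁ : Measurable fun x => (s x, f (s x) x) := s.measurable.prodMk hφ
  have hs₂ : Measurable fun z : α × β => (s z.1, z.2) :=
    (s.measurable.comp measurable_fst).prodMk measurable_snd
  ext S hS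
  rw [Measure.map_apply hs₁ hS, Measure.map_apply hs₂ hS]
  have h₁ : ∀ E, μ E = ∑ i ∈ s.range, μ (s ⁻¹' {i} ∩ E) := fun E => by
    have := s.sum_range_measure_preimage_singleton (μ.restrict E)
    rw [Measure.restrict_apply_univ] at this
    rw [← this]
    exact Finset.sum_congr rfl fun i _ => Measure.restrict_apply (s.measurableSet_fiber i)
  have h₂ : ∀ E, π E = ∑ i ∈ s.range, π (Prod.fst ⁻¹' (s ⁻¹' {i}) ∩ E) := fun E => by
    have := s.sum_range_measure_preimage_singleton ((π.restrict E).map Prod.fst)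
    rw [Measure.map_apply measurable_fst MeasurableSet.univ, Set.preimage_univ,
      Measure.restrict_apply_univ] at this
    rw [← this]
    refine Finset.sum_congr rfl fun i _ => ?_
    rw [Measure.map_apply measurable_fst (s.measurableSet_fiber i),
      Measure.restrict_apply (measurable_fst (s.measurableSet_fiber i))]
  rw [h₁, h₂]
  refine Finset.sum_congr rfl fun i _ => ?_
  -- Within cell `i`, membership in `S` only concerns the slice of `S` at `i`.
  convert hfm i (Prod.mk i ⁻¹' S) (measurable_prodMk_left hS) using 2
  · ext x
    simp +contextual
  · ext z
    simp +contextual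

/-! ### Discretisation of functions on the square. -/

/-- On the square of a Polish space, `L^p` functions are approximated by functions which only
depend on finitely many cells in each coordinate. -/
theorem MemLp.exists_simpleFunc_eLpNorm_sub_le {α : Type*} [TopologicalSpace α] [PolishSpace α]
    [MeasurableSpace α] [BorelSpace α] {ν : Measure (α × α)} [IsFiniteMeasure ν] {q : ℝ≥0∞}
    (hq : 1 ≤ q) (hq' : q ≠ ∞) {f : α × α → ℝ} (hf : MemLp f q ν) {ε : ℝ≥0∞} (hε : ε ≠ 0) :
    ∃ (s : SimpleFunc α α) (g : α × α → ℝ), Measurable g ∧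
      eLpNorm (fun z => f z - g (s z.1, s z.2)) q ν ≤ ε := by
  let := TopologicalSpace.upgradeIsCompletelyMetrizable α
  rcases isEmpty_or_nonempty α with hα | ⟨⟨a⟩⟩
  · refine ⟨⟨id, fun _ => Set.Subsingleton.measurableSet fun x => isEmptyElim x,
      Set.toFinite _⟩, 0, measurable_zero, ?_⟩
    rw [Subsingleton.elim (fun z : α × α => _) (0 : α × α → ℝ)]
    simp
  have hε2 : ε / 2 ≠ 0 := by simpa using hε
  -- Continuity of `g` turns `s n → id` into pointwise convergence; boundedness supplies the
  -- dominating constant.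
  obtain ⟨g, hfg, hg⟩ := hf.exists_boundedContinuous_eLpNorm_sub_le hq' hε2
  let s : ℕ → SimpleFunc α α := SimpleFunc.approxOn id measurable_id Set.univ a (Set.mem_univ a)
  have hs : ∀ x, Tendsto (fun n => s n x) atTop (𝓝 x) := fun x =>
    SimpleFunc.tendsto_approxOn measurable_id (Set.mem_univ a) (by simp)
  let G : ℕ → α × α → ℝ := fun n z => g (s n z.1, s n z.2)
  have hG : ∀ n, Measurable (G n) := fun n => g.continuous.measurable.comp
    (((s n).measurable.comp measurable_fst).prodMk ((s n).measurable.comp measurable_snd))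
  have hGm : ∀ n, AEStronglyMeasurable (fun z => g z - G n z) ν := fun n =>
    (g.continuous.measurable.sub (hG n)).aestronglyMeasurable
  have hlim : Tendsto (fun n => eLpNorm (fun z => g z - G n z) q ν) atTop (𝓝 0) := by
    have hq0 : q ≠ 0 := (zero_lt_one.trans_le hq).ne'
    have hqp := ENNReal.toReal_pos hq0 hq'
    simp_rw [eLpNorm_eq_lintegral_rpow_enorm_toReal hq0 hq']
    rw [← ENNReal.zero_rpow_of_pos (one_div_pos.2 hqp)]
    refine (ENNReal.continuous_rpow_const.tendsto _).comp ?_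
    rw [← lintegral_zero (μ := ν)]
    refine tendsto_lintegral_of_dominated_convergence
      (fun _ => ENNReal.ofReal (2 * ‖g‖) ^ q.toReal)
      (fun n => (g.continuous.measurable.sub (hG n)).enorm.pow_const _)
      (fun n => ae_of_all _ fun z => ?_) ?_ (ae_of_all _ fun z => ?_)
    · refine ENNReal.rpow_le_rpow ?_ hqp.le
      rw [← ofReal_norm, ← dist_eq_norm]
      exact ENNReal.ofReal_le_ofReal (g.dist_le_two_norm _ _)
    · rw [lintegral_const]
      exact ENNReal.mul_ne_top (ENNReal.rpow_ne_top_of_nonneg hqp.le ENNReal.ofReal_ne_top)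
        (measure_ne_top _ _)
    · have h : Tendsto (fun n => g z - G n z) atTop (𝓝 (g z - g z)) :=
        tendsto_const_nhds.sub ((g.continuous.tendsto z).comp ((hs z.1).prodMk_nhds (hs z.2)))
      have h' := (ENNReal.continuous_rpow_const (y := q.toReal)).tendsto _ |>.comp h.enorm
      simpa [ENNReal.zero_rpow_of_pos hqp, Function.comp_def] using h'
  obtain ⟨n, hn⟩ := (hlim.eventually (ge_mem_nhds hε2.bot_lt)).exists
  refine ⟨s n, g, g.continuous.measurable, ?_⟩
  calc eLpNorm (fun z => f z - G n z) q ν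
      = eLpNorm ((f - ⇑g) + fun z => g z - G n z) q ν := by
        congr 1; ext z; simp
    _ ≤ eLpNorm (f - ⇑g) q ν + eLpNorm (fun z => g z - G n z) q ν :=
        eLpNorm_add_le (hf.aestronglyMeasurable.sub hg.aestronglyMeasurable) (hGm n) hq
    _ ≤ ε / 2 + ε / 2 := add_le_add hfg hn
    _ = ε := ENNReal.add_halves ε

end MeasureTheory

/-! ### Distortion estimates and comparison of the infima. -/

namespace MeasureNetwork

theorem lintegral_rpow_eq_eLpNorm {α : Type*} [MeasurableSpace α] (ν : Measure α) {p : ℝ}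
    (hp : 1 ≤ p) (f : α → ℝ) :
    (∫⁻ z, ENNReal.ofReal (|f z| ^ p) ∂ν) ^ (1 / p) = eLpNorm f (ENNReal.ofReal p) ν := by
  have hp0 : 0 < p := zero_lt_one.trans_le hp
  rw [eLpNorm_eq_lintegral_rpow_enorm_toReal (by simpa using hp0) ENNReal.ofReal_ne_top,
    ENNReal.toReal_ofReal hp0.le]
  congr 1
  refine lintegral_congr fun z => ?_
  rw [← ENNReal.ofReal_rpow_of_nonneg (abs_nonneg _) hp0.le, Real.enorm_eq_ofReal_abs]

theorem memLp_ω {p : ℝ} (hp : 1 ≤ p) {X : MeasureNetwork.{u}} (hX : X.size p < ∞) :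
    MemLp X.ω (ENNReal.ofReal p) (X.μ.prod X.μ) :=
  ⟨X.measurable_ω.aestronglyMeasurable, by rwa [← lintegral_rpow_eq_eLpNorm _ hp]⟩

theorem inducedCoupling_mem_couplings {X : MeasureNetwork.{u}} {Y : MeasureNetwork.{v}}
    {φ : X.carrier → Y.carrier} (hφ : MeasurePreserving φ X.μ Y.μ) :
    inducedCoupling X Y φ ∈ couplings X Y := by
  have h : Measurable fun x => (x, φ x) := measurable_id.prodMk hφ.measurable
  refine ⟨Measure.isProbabilityMeasure_map h.aemeasurable, ?_, ?_⟩
  · rw [inducedCoupling, Measure.map_map measurable_fst h]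
    exact Measure.map_id
  · rw [inducedCoupling, Measure.map_map measurable_snd h]
    exact hφ.map_eq

theorem GW_le_GM (p : ℝ) (X : MeasureNetwork.{u}) (Y : MeasureNetwork.{v}) :
    GW p X Y ≤ GM p X Y :=
  le_iInf₂ fun _ hφ => iInf₂_le _ (inducedCoupling_mem_couplings hφ)

/-- The distortion with the first weight function replaced by `f`. -/
noncomputable def distortionWith (p : ℝ) (X : MeasureNetwork.{u}) (Y : MeasureNetwork.{v})
    (f : X.carrier × X.carrier → ℝ) (π : Measure (X.carrier × Y.carrier)) : ℝ≥0∞ :=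
  eLpNorm (fun w : (X.carrier × Y.carrier) × (X.carrier × Y.carrier) =>
    f (w.1.1, w.2.1) - Y.ω (w.1.2, w.2.2)) (ENNReal.ofReal p) (π.prod π)

theorem distortion_eq_distortionWith {p : ℝ} (hp : 1 ≤ p) (X : MeasureNetwork.{u})
    (Y : MeasureNetwork.{v}) (π : Measure (X.carrier × Y.carrier)) :
    distortion p X Y π = distortionWith p X Y X.ω π :=
  lintegral_rpow_eq_eLpNorm _ hp _

/-- Minkowski: the `X`-coordinates under `π ⊗ π` have law `μ_X ⊗ μ_X`, so the error is the same for
all couplings. -/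
theorem distortionWith_le_add {p : ℝ} (hp : 1 ≤ p) {X : MeasureNetwork.{u}}
    {Y : MeasureNetwork.{v}} {f g : X.carrier × X.carrier → ℝ} (hf : Measurable f)
    (hg : Measurable g) {π : Measure (X.carrier × Y.carrier)} (hπ : π ∈ couplings X Y) :
    distortionWith p X Y f π ≤
      distortionWith p X Y g π + eLpNorm (f - g) (ENNReal.ofReal p) (X.μ.prod X.μ) := by
  obtain ⟨_, hπX, -⟩ := hπ
  have hF : Measurable (fun w : (X.carrier × Y.carrier) × (X.carrier × Y.carrier) =>
      (w.1.1, w.2.1)) := by fun_prop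
  have hS : Measurable (fun w : (X.carrier × Y.carrier) × (X.carrier × Y.carrier) =>
      (w.1.2, w.2.2)) := by fun_prop
  have hmap : X.μ.prod X.μ = (π.prod π).map (fun w => (w.1.1, w.2.1)) := by
    rw [← hπX, Measure.map_prod_map _ _ measurable_fst measurable_fst]
    rfl
  rw [hmap, eLpNorm_map_measure (hf.sub hg).aestronglyMeasurable hF.aemeasurable]
  refine le_trans (le_of_eq ?_) (eLpNorm_add_le
    ((hg.comp hF).sub (Y.measurable_ω.comp hS)).aestronglyMeasurable
    ((hf.sub hg).comp hF).aestronglyMeasurable (by simpa using hp))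
  rw [distortionWith]
  congr 1
  ext w
  simp only [Pi.add_apply, Pi.sub_apply, Function.comp_apply]
  ring

theorem distortionWith_simpleFunc (p : ℝ) {X : MeasureNetwork.{u}} {Y : MeasureNetwork.{v}}
    (s : SimpleFunc X.carrier X.carrier) {g : X.carrier × X.carrier → ℝ} (hg : Measurable g)
    (π : Measure (X.carrier × Y.carrier)) [IsProbabilityMeasure π] :
    distortionWith p X Y (fun z => g (s z.1, s z.2)) π =
      distortionWith p X Y g (π.map fun z => (s z.1, z.2)) := by
  have hs : Measurable fun z : X.carrier × Y.carrier => (s z.1, z.2) :=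
    (s.measurable.comp measurable_fst).prodMk measurable_snd
  rw [distortionWith, distortionWith, Measure.map_prod_map _ _ hs hs, eLpNorm_map_measure]
  · rfl
  · exact ((hg.comp (by fun_prop)).sub (Y.measurable_ω.comp (by fun_prop))).aestronglyMeasurable
  · exact (hs.prodMap hs).aemeasurable

theorem GM_le_GW {p : ℝ} (hp : 1 ≤ p) {X : MeasureNetwork.{u}} {Y : MeasureNetwork.{v}}
    (hX : X.size p < ∞) (hμX : ∀ x : X.carrier, X.μ {x} = 0) : GM p X Y ≤ GW p X Y := by
  refine le_iInf₂ fun π hπ => ENNReal.le_of_forall_pos_le_add fun ε hε _ => ?_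
  have hε2 : (ε : ℝ≥0∞) / 2 ≠ 0 := by simpa using hε.ne'
  obtain ⟨s, g, hg, hsg⟩ := (memLp_ω hp hX).exists_simpleFunc_eLpNorm_sub_le
    (by simpa using hp) ENNReal.ofReal_ne_top hε2
  have := hπ.1
  have : NullSingletonClass X.μ := ⟨hμX⟩
  obtain ⟨φ, hφ, hsφ⟩ := exists_measurable_map_prodMk_eq X.μ π hπ.2.1 s
  have hs : Measurable fun z : X.carrier × Y.carrier => (s z.1, z.2) :=
    (s.measurable.comp measurable_fst).prodMk measurable_snd
  have hφ' : MeasurePreserving φ X.μ Y.μ := by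
    refine ⟨hφ, ?_⟩
    -- Equal joint laws have equal second marginals, namely `φ_# μ_X` and `μ_Y`.
    have h := congrArg (Measure.map Prod.snd) hsφ
    rw [Measure.map_map measurable_snd (s.measurable.prodMk hφ),
      Measure.map_map measurable_snd hs] at h
    exact h.trans hπ.2.2
  have hπφ := inducedCoupling_mem_couplings hφ'
  have := hπφ.1
  have hgs : Measurable fun z : X.carrier × X.carrier => g (s z.1, s z.2) := hg.comp
    ((s.measurable.comp measurable_fst).prodMk (s.measurable.comp measurable_snd))
  have heq : (inducedCoupling X Y φ).map (fun z => (s z.1, z.2)) =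
      π.map fun z => (s z.1, z.2) := by
    rw [← hsφ, inducedCoupling, Measure.map_map hs (by fun_prop)]
    rfl
  calc GM p X Y ≤ distortion p X Y (inducedCoupling X Y φ) := iInf₂_le φ hφ'
    _ = distortionWith p X Y X.ω (inducedCoupling X Y φ) := distortion_eq_distortionWith hp ..
    _ ≤ distortionWith p X Y (fun z => g (s z.1, s z.2)) (inducedCoupling X Y φ) + ε / 2 :=
        (distortionWith_le_add hp X.measurable_ω hgs hπφ).trans (by gcongr; exact hsg)
    _ = distortionWith p X Y (fun z => g (s z.1, s z.2)) π + ε / 2 := by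
        rw [distortionWith_simpleFunc p s hg, distortionWith_simpleFunc p s hg, heq]
    -- The second `ε / 2` pays for returning from the discretised weight to `ω_X`.
    _ ≤ distortionWith p X Y X.ω π + ε / 2 + ε / 2 := by
        gcongr
        refine (distortionWith_le_add hp hgs X.measurable_ω hπ).trans ?_
        rw [eLpNorm_sub_comm]
        gcongr
        exact hsg
    _ = distortion p X Y π + ε := by
        rw [add_assoc, ENNReal.add_halves, distortion_eq_distortionWith hp]

end MeasureNetwork

theorem theorem3p1 (p : ℝ) (hp : 1 ≤ p) (X : MeasureNetwork.{u}) (Y : MeasureNetwork.{v})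
    (hX : X.size p < ∞) (hY : Y.size p < ∞)
    (hμX : ∀ x : X.carrier, X.μ {x} = 0) (hμY : ∀ y : Y.carrier, Y.μ {y} = 0) :
    MeasureNetwork.GM p X Y = MeasureNetwork.GW p X Y :=
  le_antisymm (MeasureNetwork.GM_le_GW hp hX hμX) (MeasureNetwork.GW_le_GM p X Y)
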